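/- Let $\mathcal{X}$ be a measurable space and let $\mathcal{D}_T$ and $\mathcal{D}_{S_1},\dots,\mathcal{D}_{S_k}$ ($k\ge 1$) be probability distributions on $\mathcal{X}$ (the target and the $k$ source distributions). Let $\mathcal{H}$ be a class of functions $h:\mathcal{X}\to\{0,1\}$, let $\mathcal{A}_{\mathcal{H}}=\{h^{-1}(\{1\})\mid h\in\mathcal{H}\}$, and for probability distributions on $\mathcal{X}$ define the multi-source $\mathcal{H}$-divergence $$d_{\mathcal{H}}(\mathcal{D};\{\mathcal{D}_i\}_{i=1}^k)=\max_{1\le i\le k}\; 2\sup_{A\in\mathcal{A}_{\mathcal{H}}}\bigl|\mathcal{D}(A)-\mathcal{D}_i(A)\bigr|.$$ Assume that $\mathcal{H}$ has finite VC dimension $d$, i.e. $d$ is the largest integer $n\ge 0$ such that some $n$ distinct points of $\mathcal{X}$ are labelled in all $2^n$ ways by the functions in $\mathcal{H}$. Assume also that $\mathcal{H}$ satisfies the usual measurability condition: every $h\in\mathcal{H}$ is measurable and, for all $n\ge 0$, all $a\in\mathbb{R}^n$ and all $P_1,\dots,P_n\in\{\mathcal{D}_T,\mathcal{D}_{S_1},\dots,\mathcal{D}_{S_k}\}$,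 the function $(x_1,\dots,x_n)\mapsto\sup_{h\in\mathcal{H}}\bigl|\sum_{j=1}^n a_jh(x_j)\bigr|$ is measurable with respect to the completion of $P_1\otimes\cdots\otimes P_n$ (this holds, for instance, if $\mathcal{H}$ is a countable class of measurable functions). Let $m\ge d$, and let $\widehat{\mathcal{D}}_T,\widehat{\mathcal{D}}_{S_1},\dots,\widehat{\mathcal{D}}_{S_k}$ be the empirical distributions of $m$ i.i.d. samples from each of $\mathcal{D}_T,\mathcal{D}_{S_1},\dots,\mathcal{D}_{S_k}$, all $(k+1)m$ samples being independent. Then for every $\varepsilon>0$, $$\Pr\left(\left|d_{\mathcal{H}}(\mathcal{D}_T;\{\mathcal{D}_{S_i}\}_{i=1}^k)-d_{\mathcal{H}}(\widehat{\mathcal{D}}_T;\{\widehat{\mathcal{D}}_{S_i}\}_{i=1}^k)\right|\ge\varepsilon\right)\;\le\;4k\left(\frac{em}{d}\right)^{d}\exp\left(-\frac{m\varepsilon^2}{8}\right),$$ where $(em/d)^d$ is read as $1$ if $d=0$. -/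

import Mathlib

open MeasureTheory ProbabilityTheory

noncomputable section

namespace MultiSource

variable {X : Type*}

/-- The collection of subsets of `X` that are the support `h⁻¹({1})` of some hypothesis
`h : X → {0, 1}` of the class `H`. -/
def supports (H : Set (X → Bool)) : Set (Set X) :=
  {A | ∃ h ∈ H, A = h ⁻¹' {true}}

/-- The growth function: the largest number of label vectors `(h(x₁), …, h(xₘ))`, `h ∈ H`, that
is realized on `m` distinct points of `X` (and `0` if `X` has fewer than `m` points; the set of
values is bounded by `2 ^ m`). -/
def growthFunction (H : Set (X → Bool)) (m : ℕ) : ℕ :=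
  sSup {n | ∃ x : Fin m → X, Function.Injective x ∧
    n = ((fun (h : X → Bool) (j : Fin m) => h (x j)) '' H).ncard}

/-- `H` has VC dimension `d`: the number `d` is the maximum of all `m` with
`growthFunction H m = 2 ^ m`. -/
def HasVCDim (H : Set (X → Bool)) (d : ℕ) : Prop :=
  IsGreatest {m : ℕ | growthFunction H m = 2 ^ m} d

variable [MeasurableSpace X]

/-- The `H`-divergence of two distributions:
twice the supremum of `|D(A) - D'(A)|` over the supports `A` of hypotheses in `H`. -/
def hDivergence (H : Set (X → Bool)) (D D' : Measure X) : ℝ :=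
  2 * ⨆ A : supports H, |D.real (A : Set X) - D'.real (A : Set X)|

/-- The `H`-divergence between a target distribution and a family of `k` source distributions:
the maximum over the sources of the `H`-divergence from the target. -/
def multiHDivergence (H : Set (X → Bool)) {k : ℕ} (DT : Measure X) (DS : Fin k → Measure X) : ℝ :=
  ⨆ i : Fin k, hDivergence H DT (DS i)

/-- The empirical distribution `(1/m) ∑ⱼ δ_{xⱼ}` of a sample of `m` points. -/
def empiricalMeasure {m : ℕ} (x : Fin m → X) : Measure X :=
  (m : ENNReal)⁻¹ • ∑ j, Measure.dirac (x j)

/-- The usual measurability condition on a hypothesis class in empirical process theory, for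
samples drawn independently from distributions in the collection `𝒟`: every hypothesis is
measurable and, for all `n` and all real coefficients `a₁, …, aₙ`, the function
`(x₁, …, xₙ) ↦ sup_{h ∈ H} |∑ⱼ aⱼ h(xⱼ)|` is measurable with respect to the completion of
`P₁ ⊗ ⋯ ⊗ Pₙ` whenever `P₁, …, Pₙ ∈ 𝒟`. -/
structure IsMeasurableClass (H : Set (X → Bool)) (𝒟 : Set (Measure X)) : Prop where
  measurable : ∀ h ∈ H, Measurable h
  aemeasurable_iSup : ∀ (n : ℕ) (P : Fin n → Measure X), (∀ j, P j ∈ 𝒟) → ∀ a : Fin n → ℝ,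
    AEMeasurable (fun x : Fin n → X => ⨆ h : H, |∑ j, a j * (if h.1 (x j) then 1 else 0)|)
      (Measure.pi P)

end MultiSource

end

/-! Halving the divergence and a union bound over the sources reduce the claim to one pair of laws,
with `δ = ε / 2` and target `4 (em/d)^d exp(-mδ²/2)`. The two tails of the supremum behave
differently. A supremum that is too small forces a single nearly optimal hypothesis to deviate, so
Hoeffding suffices (`pi_supDiff_le_le`).

For the upper tail, each real point gets twelve independent ghosts, giving `2m` blocks of thirteen
points with a common law. The pool statistic gives a real label the weight `G = log ((1+δ)/(1-δ))`
and subtracts `2δ` times the block mean, with opposite signs for the two samples. On a large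
deviation, Jensen over the ghosts keeps its exponential large (`le_lintegral_ghost`). Conversely,
the pool law is invariant under cyclic shifts inside blocks. For a fixed label vector the shift
average factorizes, and `1 + x ≤ exp x` bounds it by `(1-δ²)^(-m)` (`sum_shift_exp_le`).
Sauer–Shelah on `26m` points and Markov's inequality then give `pi_supSum_ge_le`.

The larger pool costs a factor `26^d`, but the exponent per sample is now `δG + log (1-δ²) -
(2/13)δ²`, which exceeds `δ²/2`. If the target bound is below one, `d/m` is small compared with `δ²`
and the surplus pays for `26^d` (`pool_bound_le`); otherwise there is nothing to prove. Blocks of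
`N` points would cost `(2N)^d` and lose `(2/N)δ²`; `N = 13` balances the two well enough. -/

namespace MultiSource

/-! ### Numerical comparison of the exponents -/

/-- The quartic polynomial whose product with `D` is a lower bound for the exponent rate that
remains after paying for the ghost sample. -/
noncomputable def ratePoly (D : ℝ) : ℝ := 9 / 26 + D / 6 + D ^ 2 / 15 + D ^ 3 / 28 + D ^ 4 / 45

/-- Bernstein basis of degree nine, the degree of `D * ratePoly D ^ 2`; in it, positivity on an
interval becomes a linear problem for the coefficients. -/
lemma bernstein_basis_nonneg {a b D : ℝ} (ha : a ≤ D) (hb : D ≤ b) (i : ℕ) :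
    0 ≤ (D - a) ^ i * (b - D) ^ (9 - i) :=
  mul_nonneg (pow_nonneg (by linarith) _) (pow_nonneg (by linarith) _)

/-- The four intervals use tangents to `-log` at `1/k` with `k = 16, 11.32, 8, 5.66`, close to
half-integer powers of two, so that `log k` is bounded below through `log 2 > 0.6931`. The constant
`3.25824` stands for `log 26`. -/
lemma ratePoly_ineq_of_le_half {D : ℝ} (ha : 0 ≤ D) (hb : D ≤ 1 / 2) :
    3.25824 ^ 2 / 2 < ratePoly D * ((2 + 4 * 0.6931) * 3.25824 - 16 * D * ratePoly D) := by
  have h := bernstein_basis_nonneg ha hb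
  have h0 := h 0; have h1 := h 1; have h2 := h 2; have h3 := h 3; have h4 := h 4
  have h5 := h 5; have h6 := h 6; have h7 := h 7; have h8 := h 8; have h9 := h 9
  norm_num at h0 h1 h2 h3 h4 h5 h6 h7 h8 h9
  unfold ratePoly
  linarith

lemma ratePoly_ineq_of_mem_Icc₁ {D : ℝ} (ha : 1 / 2 ≤ D) (hb : D ≤ 13 / 20) :
    3.25824 ^ 2 / 2 < ratePoly D * ((2 + 7 / 2 * 0.6931) * 3.25824 - 11.32 * D * ratePoly D) := by
  have h := bernstein_basis_nonneg ha hb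
  have h0 := h 0; have h1 := h 1; have h2 := h 2; have h3 := h 3; have h4 := h 4
  have h5 := h 5; have h6 := h 6; have h7 := h 7; have h8 := h 8; have h9 := h 9
  norm_num at h0 h1 h2 h3 h4 h5 h6 h7 h8 h9
  unfold ratePoly
  linarith

lemma ratePoly_ineq_of_mem_Icc₂ {D : ℝ} (ha : 13 / 20 ≤ D) (hb : D ≤ 4 / 5) :
    3.25824 ^ 2 / 2 < ratePoly D * ((2 + 3 * 0.6931) * 3.25824 - 8 * D * ratePoly D) := by
  have h := bernstein_basis_nonneg ha hb
  have h0 := h 0; have h1 := h 1; have h2 := h 2; have h3 := h 3; have h4 := h 4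
  have h5 := h 5; have h6 := h 6; have h7 := h 7; have h8 := h 8; have h9 := h 9
  norm_num at h0 h1 h2 h3 h4 h5 h6 h7 h8 h9
  unfold ratePoly
  linarith

lemma ratePoly_ineq_of_mem_Icc₃ {D : ℝ} (ha : 4 / 5 ≤ D) (hb : D ≤ 1) :
    3.25824 ^ 2 / 2 < ratePoly D * ((2 + 5 / 2 * 0.6931) * 3.25824 - 5.66 * D * ratePoly D) := by
  have h := bernstein_basis_nonneg ha hb
  have h0 := h 0; have h1 := h 1; have h2 := h 2; have h3 := h 3; have h4 := h 4
  have h5 := h 5; have h6 := h 6; have h7 := h 7; have h8 := h 8; have h9 := h 9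
  norm_num at h0 h1 h2 h3 h4 h5 h6 h7 h8 h9
  unfold ratePoly
  linarith

lemma log_lower_of_two_pow_le {k : ℝ} {n : ℕ} (h : (2 : ℝ) ^ n ≤ k ^ 2) :
    n / 2 * 0.6931 ≤ Real.log k := by
  have h1 := Real.log_le_log (by positivity) h
  rw [Real.log_pow, Real.log_pow] at h1
  have h2 := Real.log_two_gt_d9
  have : (n : ℝ) * 0.6931 ≤ n * Real.log 2 := by gcongr; linarith
  push_cast at h1
  linarith

/-- The convex function `-log` lies above its tangent at `1/k`. -/
lemma le_neg_log {k w : ℝ} (hk : 0 < k) (hw : 0 < w) :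
    1 + Real.log k - k * w ≤ -Real.log w := by
  have := Real.log_le_sub_one_of_pos (mul_pos hk hw)
  rw [Real.log_mul hk.ne' hw.ne'] at this
  linarith

lemma lt_mul_one_sub_log_of_ratePoly {D k c : ℝ} (hD : 0 < D) (hk : 0 < k)
    (hc : c ≤ Real.log k)
    (h : 3.25824 ^ 2 / 2 < ratePoly D * ((2 + c) * 3.25824 - k * D * ratePoly D)) :
    D / 2 < D * ratePoly D / 3.25824 * (1 - Real.log (D * ratePoly D / 3.25824)) := by
  have hp : 0 < ratePoly D := by unfold ratePoly; positivity
  set w := D * ratePoly D / 3.25824 with hw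
  have hw0 : 0 < w := by positivity
  have h1 := le_neg_log hk hw0
  have h2 : w * (2 + c - k * w) ≤ w * (1 - Real.log w) := by
    exact mul_le_mul_of_nonneg_left (by linarith) hw0.le
  refine lt_of_lt_of_le ?_ h2
  have h3 : w * (2 + c - k * w) =
      D * (ratePoly D * ((2 + c) * 3.25824 - k * D * ratePoly D)) / 3.25824 ^ 2 := by
    rw [hw]; field_simp
  rw [h3, lt_div_iff₀ (by positivity)]
  nlinarith

lemma ratePoly_bound {D : ℝ} (hD : 0 < D) (hD1 : D ≤ 1) :
    D / 2 < D * ratePoly D / 3.25824 * (1 - Real.log (D * ratePoly D / 3.25824)) := by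
  rcases le_total D (1 / 2) with h | h
  · exact lt_mul_one_sub_log_of_ratePoly hD (by norm_num)
      ((log_lower_of_two_pow_le (n := 8) (by norm_num)).trans' (by norm_num))
      (ratePoly_ineq_of_le_half hD.le h)
  rcases le_total D (13 / 20) with h' | h'
  · exact lt_mul_one_sub_log_of_ratePoly hD (by norm_num)
      ((log_lower_of_two_pow_le (n := 7) (by norm_num)).trans' (by norm_num))
      (ratePoly_ineq_of_mem_Icc₁ h h')
  rcases le_total D (4 / 5) with h'' | h''
  · exact lt_mul_one_sub_log_of_ratePoly hD (by norm_num)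
      ((log_lower_of_two_pow_le (n := 6) (by norm_num)).trans' (by norm_num))
      (ratePoly_ineq_of_mem_Icc₂ h' h'')
  · exact lt_mul_one_sub_log_of_ratePoly hD (by norm_num)
      ((log_lower_of_two_pow_le (n := 5) (by norm_num)).trans' (by norm_num))
      (ratePoly_ineq_of_mem_Icc₃ h'' hD1)

/-- The derivative of `w (1 - log w)` is `-log w`, nonnegative on `(0, 1]`; the proof uses `log x ≤
x - 1` instead. -/
lemma mul_one_sub_log_mono {w v : ℝ} (hw : 0 < w) (hwv : w ≤ v) (hv : v ≤ 1) :
    w * (1 - Real.log w) ≤ v * (1 - Real.log v) := by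
  have hv0 : 0 < v := hw.trans_le hwv
  have h1 := Real.log_le_sub_one_of_pos (div_pos hv0 hw)
  rw [Real.log_div hv0.ne' hw.ne'] at h1
  have h2 : w * (Real.log v - Real.log w) ≤ v - w := by
    calc w * (Real.log v - Real.log w) ≤ w * (v / w - 1) := by gcongr
      _ = v - w := by field_simp
  have h3 := Real.log_nonpos hv0.le hv
  nlinarith [mul_nonneg (sub_nonneg.2 hwv) (neg_nonneg.2 h3)]

/-- Works because `26 ^ 4` exceeds `exp 13` by only about three percent, where `log x ≤ x - 1` is
sharp. -/
lemma log_twentySix_le : Real.log 26 ≤ 3.25824 := by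
  have he : (2.7182818283 : ℝ) ^ 13 ≤ Real.exp 13 := by
    have : Real.exp 13 = Real.exp 1 ^ 13 := by rw [← Real.exp_nat_mul]; norm_num
    rw [this]
    gcongr
    exact Real.exp_one_gt_d9.le
  have h1 := Real.log_le_sub_one_of_pos (x := 26 ^ 4 / Real.exp 13) (by positivity)
  rw [Real.log_div (by norm_num) (by positivity), Real.log_pow, Real.log_exp] at h1
  have h2 : 26 ^ 4 / Real.exp 13 ≤ 26 ^ 4 / (2.7182818283 : ℝ) ^ 13 := by gcongr
  have h3 : 26 ^ 4 / (2.7182818283 : ℝ) ^ 13 ≤ 1.03293 := by norm_num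
  push_cast at h1
  linarith

/-- By monotonicity it is enough to test the extremal `v`, which is what `ratePoly_bound` does. Here
`v = d / m` and `D = δ ^ 2`. -/
lemma log_twentySix_mul_le {v D : ℝ} (hv : 0 < v) (hv1 : v ≤ 1) (hD : 0 < D) (hD1 : D ≤ 1)
    (h : v * (1 - Real.log v) ≤ D / 2) : Real.log 26 * v ≤ D * ratePoly D := by
  have hp : 0 < ratePoly D := by unfold ratePoly; positivity
  by_contra! hc
  have hw : D * ratePoly D / 3.25824 ≤ v := by
    rw [div_le_iff₀ (by norm_num)]
    nlinarith [log_twentySix_le]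
  have := mul_one_sub_log_mono (by positivity) hw hv1
  linarith [ratePoly_bound hD hD1]

/-- The power series of the right side is `∑ δ^(2n+2) / ((n+1)(2n+1))`, with positive terms; five
are kept. -/
lemma rate_ge_poly {δ : ℝ} (h0 : 0 < δ) (h1 : δ < 1) :
    δ ^ 2 + δ ^ 4 / 6 + δ ^ 6 / 15 + δ ^ 8 / 28 + δ ^ 10 / 45 ≤
      δ * (Real.log (1 + δ) - Real.log (1 - δ)) + Real.log (1 - δ ^ 2) := by
  have ha := (Real.hasSum_log_sub_log_of_abs_lt_one (x := δ) (by rw [abs_of_pos h0]; exact h1)).mul_left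
    δ
  have hb := Real.hasSum_pow_div_log_of_abs_lt_one (x := δ ^ 2)
    (by rw [abs_of_pos (by positivity)]; nlinarith)
  have hc := ha.sub hb
  rw [sub_neg_eq_add] at hc
  refine le_trans (le_of_eq ?_) (sum_le_hasSum (Finset.range 5) ?_ hc)
  · simp only [Finset.sum_range_succ, Finset.sum_range_zero]
    push_cast
    ring
  · intro n _
    have h2 : δ * (2 * (1 / (2 * n + 1)) * δ ^ (2 * n + 1)) - (δ ^ 2) ^ (n + 1) / (n + 1) =
      (δ ^ 2) ^ (n + 1) * (2 / (2 * n + 1) - 1 / (n + 1)) := by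
      rw [← pow_mul]; ring
    rw [h2]
    refine mul_nonneg (by positivity) ?_
    rw [sub_nonneg, div_le_div_iff₀ (by positivity) (by positivity)]
    linarith

/-- The leading `δ²` splits as `9/26 + 17/26`. Of the second part, `2/13` is lost to the pool and
the remaining `1/2` is the target exponent. -/
lemma rate_ge_ratePoly {δ : ℝ} (h0 : 0 < δ) (h1 : δ < 1) :
    δ ^ 2 * ratePoly (δ ^ 2) + 17 / 26 * δ ^ 2 ≤
      δ * (Real.log (1 + δ) - Real.log (1 - δ)) + Real.log (1 - δ ^ 2) := by
  refine le_trans (le_of_eq ?_) (rate_ge_poly h0 h1)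
  unfold ratePoly
  ring

/-- One block of a shift average, for the sign `+1`. -/
lemma block_pos {δ q : ℝ} (h1 : δ < 1) :
    (1 - δ + 2 * δ * q) / (1 - δ) * Real.exp (-(2 * δ * q)) ≤ Real.exp (-δ) / (1 - δ) := by
  have h := Real.add_one_le_exp (-δ + 2 * δ * q)
  have : Real.exp (-δ) = Real.exp (-δ + 2 * δ * q) * Real.exp (-(2 * δ * q)) := by
    rw [← Real.exp_add]; ring_nf
  rw [this, div_mul_eq_mul_div]
  have : 0 < 1 - δ := by linarith
  gcongr
  linarith

/-- One block of a shift average, for the sign `-1`. -/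
lemma block_neg {δ q : ℝ} (h0 : 0 < δ) :
    (1 + δ - 2 * δ * q) / (1 + δ) * Real.exp (2 * δ * q) ≤ Real.exp δ / (1 + δ) := by
  have h := Real.add_one_le_exp (δ - 2 * δ * q)
  have : Real.exp δ = Real.exp (δ - 2 * δ * q) * Real.exp (2 * δ * q) := by
    rw [← Real.exp_add]; ring_nf
  rw [this, div_mul_eq_mul_div]
  gcongr
  linarith

lemma mul_log_twentySix_le {m d : ℕ} {δ : ℝ} (hd : 1 ≤ d) (hdm : d ≤ m) (h0 : 0 < δ) (h1 : δ < 1)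
    (h : d * (1 + Real.log (m / d)) ≤ m * δ ^ 2 / 2) :
    d * Real.log 26 ≤ m * (δ * (Real.log (1 + δ) - Real.log (1 - δ)) + Real.log (1 - δ ^ 2)
      - 17 / 26 * δ ^ 2) := by
  have hd0 : (0 : ℝ) < d := by exact_mod_cast hd
  have hm0 : (0 : ℝ) < m := by exact_mod_cast hd.trans hdm
  have hv : (d / m : ℝ) * (1 - Real.log (d / m)) ≤ δ ^ 2 / 2 := by
    rw [Real.log_div hm0.ne' hd0.ne'] at h
    rw [Real.log_div hd0.ne' hm0.ne', div_mul_eq_mul_div, div_le_iff₀ hm0]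
    linarith
  have h2 := log_twentySix_mul_le (div_pos hd0 hm0) (by rw [div_le_one hm0]; exact_mod_cast hdm)
    (by positivity) (by nlinarith) hv
  have h3 := rate_ge_ratePoly h0 h1
  calc d * Real.log 26 = m * (Real.log 26 * (d / m)) := by field_simp
    _ ≤ _ := by gcongr; linarith

/-- The price `26 ^ d` of the enlarged pool is absorbed by the improved exponent whenever the
deviation bound is non-trivial. -/
lemma pool_bound_le {m d : ℕ} {δ : ℝ} (hdm : d ≤ m) (h0 : 0 < δ) (h1 : δ < 1)
    (h : d * (1 + Real.log (m / d)) ≤ m * δ ^ 2 / 2) :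
    (Real.exp 1 * (26 * m) / d) ^ d * Real.exp (-(m * (δ * (Real.log (1 + δ) - Real.log (1 - δ))
      + Real.log (1 - δ ^ 2) - 2 / 13 * δ ^ 2))) ≤
      (Real.exp 1 * m / d) ^ d * Real.exp (-(m * δ ^ 2 / 2)) := by
  have h26 : Real.exp (d * Real.log 26) = 26 ^ d := by
    rw [mul_comm, Real.exp_mul, Real.exp_log (by norm_num), Real.rpow_natCast]
  have h2 : (Real.exp 1 * (26 * m) / d) ^ d =
      (Real.exp 1 * m / d) ^ d * Real.exp (d * Real.log 26) := by
    rw [h26, ← mul_pow]; ring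
  rw [h2, mul_assoc, ← Real.exp_add]
  gcongr
  rcases Nat.eq_zero_or_pos d with rfl | hd
  · have h3 := rate_ge_ratePoly h0 h1
    have h4 : 0 ≤ ratePoly (δ ^ 2) := by unfold ratePoly; positivity
    have h5 : (m : ℝ) * (17 / 26 * δ ^ 2) ≤
      m * (δ * (Real.log (1 + δ) - Real.log (1 - δ)) + Real.log (1 - δ ^ 2)) := by
      gcongr; nlinarith [mul_nonneg (sq_nonneg δ) h4]
    simp only [CharP.cast_eq_zero, zero_mul, zero_add]
    linarith
  · linarith [mul_log_twentySix_le hd hdm h0 h1 h]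

lemma one_le_bound_of_lt {m d : ℕ} {δ : ℝ} (hdm : d ≤ m)
    (h : m * δ ^ 2 / 2 < d * (1 + Real.log (m / d))) :
    1 ≤ (Real.exp 1 * m / d) ^ d * Real.exp (-(m * δ ^ 2 / 2)) := by
  rcases Nat.eq_zero_or_pos d with rfl | hd
  · simp only [CharP.cast_eq_zero, zero_mul] at h
    exact absurd h (not_lt.2 (by positivity))
  have hd0 : (0 : ℝ) < d := by exact_mod_cast hd
  have hm0 : (0 : ℝ) < m := by exact_mod_cast (show 0 < d from hd).trans_le hdm
  have : (Real.exp 1 * m / d) ^ d = Real.exp (d * (1 + Real.log (m / d))) := by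
    rw [mul_comm (d : ℝ), Real.exp_mul, Real.exp_add, Real.exp_log (by positivity),
      Real.rpow_natCast, mul_div_assoc]
  rw [this, ← Real.exp_add, Real.one_le_exp_iff]
  linarith

/-! ### Counting label vectors -/

/-- The elementary bound `∑_{i ≤ d} C(n, i) ≤ (e n / d) ^ d`. -/
lemma sum_choose_le {n d : ℕ} (hdn : d ≤ n) :
    ((∑ i ∈ Finset.range (d + 1), n.choose i : ℕ) : ℝ) ≤ (Real.exp 1 * n / d) ^ d := by
  rcases Nat.eq_zero_or_pos d with rfl | hd
  · simp
  have hd0 : (0 : ℝ) < d := by exact_mod_cast hd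
  have hn0 : (0 : ℝ) < n := by exact_mod_cast (show 0 < d from hd).trans_le hdn
  have hr : (d / n : ℝ) ≤ 1 := by rw [div_le_one hn0]; exact_mod_cast hdn
  -- As `d/n ≤ 1`, replacing `(d/n)^d` by `(d/n)^i` for `i ≤ d` only increases the sum, and the full
  -- sum is binomial.
  have h1 : ((∑ i ∈ Finset.range (d + 1), n.choose i : ℕ) : ℝ) * (d / n) ^ d ≤ Real.exp 1 ^ d := by
    push_cast
    rw [Finset.sum_mul]
    calc ∑ i ∈ Finset.range (d + 1), (n.choose i : ℝ) * (d / n) ^ d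
        ≤ ∑ i ∈ Finset.range (d + 1), (n.choose i : ℝ) * (d / n) ^ i := by
          refine Finset.sum_le_sum fun i hi => ?_
          gcongr ?_ * ?_
          exact pow_le_pow_of_le_one (by positivity) hr
            (Nat.lt_succ_iff.1 (Finset.mem_range.1 hi))
      _ ≤ ∑ i ∈ Finset.range (n + 1), (n.choose i : ℝ) * (d / n) ^ i :=
          Finset.sum_le_sum_of_subset_of_nonneg (Finset.range_subset_range.2 (by omega))
            fun _ _ _ => by positivity
      _ = (d / n + 1) ^ n := by
          rw [add_pow]; exact Finset.sum_congr rfl fun i _ => by ring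
      _ ≤ Real.exp (d / n) ^ n := by gcongr; exact Real.add_one_le_exp _
      _ = Real.exp 1 ^ d := by
          rw [← Real.exp_nat_mul, ← Real.exp_nat_mul]; congr 1; field_simp
  have h2 : (Real.exp 1 * n / d) ^ d = Real.exp 1 ^ d / (d / n) ^ d := by
    rw [← div_pow]; congr 1; field_simp
  rw [h2, le_div_iff₀ (by positivity)]
  exact h1

variable {X : Type*}

/-- The label vectors that `H` realizes on the points `z`. -/
noncomputable def traces {ι : Type*} [Fintype ι] [DecidableEq ι] (H : Set (X → Bool)) (z : ι → X) :
    Finset (ι → Bool) :=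
  ((fun (h : X → Bool) (j : ι) => h (z j)) '' H).toFinite.toFinset

lemma mem_traces {ι : Type*} [Fintype ι] [DecidableEq ι] {H : Set (X → Bool)} {z : ι → X}
    {t : ι → Bool} : t ∈ traces H z ↔ ∃ h ∈ H, (fun j => h (z j)) = t := by
  simp [traces]

lemma growthFunction_eq_two_pow {H : Set (X → Bool)} {n : ℕ} (x : Fin n → X)
    (hx : Function.Injective x) (h : ∀ t : Fin n → Bool, ∃ f ∈ H, ∀ j, f (x j) = t j) :
    growthFunction H n = 2 ^ n := by
  have hle : ∀ A : Set (Fin n → Bool), A.ncard ≤ 2 ^ n := fun A => by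
    refine (Set.ncard_le_ncard (Set.subset_univ A)).trans ?_
    simp [Set.ncard_univ]
  refine le_antisymm ?_ ?_
  · refine csSup_le ⟨_, x, hx, rfl⟩ ?_
    rintro _ ⟨y, -, rfl⟩
    exact hle _
  · refine le_csSup ⟨2 ^ n, ?_⟩ ⟨x, hx, ?_⟩
    · rintro _ ⟨y, -, rfl⟩
      exact hle _
    · have : (fun (f : X → Bool) (j : Fin n) => f (x j)) '' H = Set.univ := by
        refine Set.eq_univ_of_forall fun t => ?_
        obtain ⟨f, hf, hft⟩ := h t
        exact ⟨f, hf, funext hft⟩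
      rw [this]
      simp [Set.ncard_univ]

/-- The Sauer–Shelah bound on the number of label vectors. -/
lemma card_traces_le {ι : Type*} [Fintype ι] [DecidableEq ι] {H : Set (X → Bool)} {d : ℕ}
    (hVC : HasVCDim H d) (z : ι → X) :
    (traces H z).card ≤ ∑ i ∈ Finset.range (d + 1), (Fintype.card ι).choose i := by
  classical
  set 𝒜 : Finset (Finset ι) := (traces H z).image fun t => Finset.univ.filter fun j => t j = true
    with h𝒜
  have hcard : (traces H z).card = 𝒜.card := by
    rw [h𝒜, Finset.card_image_of_injective]
    intro t t' h
    funext j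
    have := congrArg (j ∈ ·) h
    simpa using this
  have hdim : 𝒜.vcDim ≤ d := by
    refine Finset.sup_le fun s hs => ?_
    rw [Finset.mem_shatterer] at hs
    have key : ∀ t ⊆ s, ∃ f ∈ H, ∀ j ∈ s, f (z j) = true ↔ j ∈ t := by
      intro t ht
      obtain ⟨u, hu, hut⟩ := hs ht
      simp only [h𝒜, Finset.mem_image, mem_traces] at hu
      obtain ⟨_, ⟨f, hf, rfl⟩, rfl⟩ := hu
      refine ⟨f, hf, fun j hj => ?_⟩
      rw [← hut]; simp [hj]
    refine hVC.2 (growthFunction_eq_two_pow (fun j => z (s.equivFin.symm j)) ?_ ?_)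
    -- The points `z` may repeat, but a shattered index set cannot contain a repetition: some
    -- hypothesis labels one index `true` and all others `false`.
    · intro i j hij
      obtain ⟨f, -, hf⟩ := key {(s.equivFin.symm i : ι)} (by simp)
      have h1 := (hf _ (s.equivFin.symm i).2).2 (by simp)
      have h2 := (hf _ (s.equivFin.symm j).2).1 (by simpa [← hij] using h1)
      simp only [Finset.mem_singleton] at h2
      exact (s.equivFin.symm.injective (Subtype.ext h2)).symm
    · intro t
      obtain ⟨f, hf, hft⟩ := key (s.filter fun j => ∃ hj : j ∈ s, t (s.equivFin ⟨j, hj⟩) = true)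
        (Finset.filter_subset _ _)
      refine ⟨f, hf, fun j => ?_⟩
      have := hft _ (s.equivFin.symm j).2
      rw [Bool.eq_iff_iff, this]
      simp
  rw [hcard]
  refine 𝒜.card_le_card_shatterer.trans (Finset.card_shatterer_le_sum_vcDim.trans ?_)
  refine Finset.sum_le_sum_of_subset ?_
  intro i hi
  simp only [Finset.mem_Iic, Finset.mem_range] at *
  omega

lemma HasVCDim.nonempty {H : Set (X → Bool)} {d : ℕ} (hVC : HasVCDim H d) : H.Nonempty := by
  by_contra h
  rw [Set.not_nonempty_iff_eq_empty] at h
  subst h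
  have h1 : growthFunction (∅ : Set (X → Bool)) d = 2 ^ d := hVC.1
  have h2 : growthFunction (∅ : Set (X → Bool)) d ≤ 0 := by
    rcases Set.eq_empty_or_nonempty {n | ∃ x : Fin d → X, Function.Injective x ∧
      n = ((fun (h : X → Bool) (j : Fin d) => h (x j)) '' ∅).ncard} with h | h
    · simp only [growthFunction, h]; simp
    · refine csSup_le h ?_
      rintro _ ⟨x, -, rfl⟩
      simp
  have := Nat.two_pow_pos d
  omega

/-! ### Averaging the pool statistic over shifts -/

/-- The supremum over `H` of the absolute value of a weighted sum of labels. -/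
noncomputable def supSum (H : Set (X → Bool)) {ι : Type*} [Fintype ι] (w : ι → ℝ) (z : ι → X) : ℝ :=
  ⨆ h : H, |∑ j, w j * (if h.1 (z j) then 1 else 0)|

section supSum

variable {ι : Type*} [Fintype ι] {H : Set (X → Bool)} (w : ι → ℝ) (z : ι → X)

lemma finite_range_abs_sum :
    (Set.range fun h : H => |∑ j, w j * (if h.1 (z j) then 1 else 0)|).Finite := by
  classical
  refine (Set.finite_range fun t : ι → Bool => |∑ j, w j * (if t j then (1 : ℝ) else 0)|).subset ?_
  rintro _ ⟨h, rfl⟩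
  exact ⟨fun j => h.1 (z j), rfl⟩

lemma abs_sum_le_supSum {h : X → Bool} (hh : h ∈ H) :
    |∑ j, w j * (if h (z j) then 1 else 0)| ≤ supSum H w z :=
  le_ciSup (finite_range_abs_sum w z).bddAbove (⟨h, hh⟩ : H)

lemma exists_supSum_eq (hne : H.Nonempty) :
    ∃ h ∈ H, supSum H w z = |∑ j, w j * (if h (z j) then 1 else 0)| := by
  have : Nonempty H := hne.to_subtype
  obtain ⟨h, hh⟩ := (Set.range_nonempty _).csSup_mem (finite_range_abs_sum (H := H) w z)
  exact ⟨h.1, h.2, hh.symm⟩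

end supSum

lemma exp_abs_le (x : ℝ) : Real.exp |x| ≤ Real.exp x + Real.exp (-x) := by
  rcases abs_cases x with ⟨h, -⟩ | ⟨h, -⟩ <;> rw [h] <;>
    linarith [Real.exp_pos x, Real.exp_pos (-x)]

/-- The weight of the pool point `(j, l)`: one real point for `l = 0` against twelve ghosts. -/
noncomputable def poolWeight {m : ℕ} (δ : ℝ) (p : (Fin m ⊕ Fin m) × Fin 13) : ℝ :=
  Sum.elim (fun _ => 1) (fun _ => -1) p.1 *
    (if p.2 = 0 then Real.log (1 + δ) - Real.log (1 - δ) - 2 * δ / 13 else -(2 * δ / 13))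

/-- A shift changes only which point occupies the real slot `0`; the block mean is unaffected. -/
lemma sum_fin_shift (δ G : ℝ) (f : Fin 13 → Bool) (a : Fin 13) :
    ∑ l, (if l = 0 then G - 2 * δ / 13 else -(2 * δ / 13)) * (if f (l + a) then (1 : ℝ) else 0) =
      (if f a then G else 0) - 2 * δ * ((∑ l, if f l then (1 : ℝ) else 0) / 13) := by
  have h1 : ∀ l : Fin 13, (if l = 0 then G - 2 * δ / 13 else -(2 * δ / 13)) *
      (if f (l + a) then (1 : ℝ) else 0) = (if l = 0 then (if f (l + a) then G else 0) else 0) -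
        2 * δ / 13 * (if f (l + a) then (1 : ℝ) else 0) := by
    intro l; split_ifs <;> ring
  rw [Finset.sum_congr rfl fun l _ => h1 l, Finset.sum_sub_distrib, ← Finset.mul_sum,
    Fintype.sum_equiv (Equiv.addRight a) (fun l => if f (l + a) then (1 : ℝ) else 0)
      (fun l => if f l then (1 : ℝ) else 0) (fun l => rfl)]
  simp
  ring

lemma sum_exp_ite (G : ℝ) (f : Fin 13 → Bool) :
    ∑ a, Real.exp (if f a then G else 0) =
      13 * (1 + (∑ l, if f l then (1 : ℝ) else 0) / 13 * (Real.exp G - 1)) := by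
  have h1 : ∀ a, Real.exp (if f a then G else 0) =
      1 + (if f a then (1 : ℝ) else 0) * (Real.exp G - 1) := by
    intro a; split_ifs <;> simp
  rw [Finset.sum_congr rfl fun a _ => h1 a, Finset.sum_add_distrib, ← Finset.sum_mul]
  simp
  ring

lemma exp_logRatio {δ : ℝ} (h0 : 0 < δ) (h1 : δ < 1) :
    Real.exp (Real.log (1 + δ) - Real.log (1 - δ)) = (1 + δ) / (1 - δ) := by
  rw [Real.exp_sub, Real.exp_log (by linarith), Real.exp_log (by linarith)]

lemma sum_block_pos {δ : ℝ} (h0 : 0 < δ) (h1 : δ < 1) (f : Fin 13 → Bool) :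
    ∑ a, Real.exp (∑ l, (if l = 0 then Real.log (1 + δ) - Real.log (1 - δ) - 2 * δ / 13
      else -(2 * δ / 13)) * (if f (l + a) then (1 : ℝ) else 0)) ≤
      13 * (Real.exp (-δ) / (1 - δ)) := by
  have hd : 1 - δ ≠ 0 := by linarith
  simp_rw [sum_fin_shift, sub_eq_add_neg _ (2 * δ * _), Real.exp_add]
  rw [← Finset.sum_mul, sum_exp_ite, exp_logRatio h0 h1, mul_assoc]
  refine mul_le_mul_of_nonneg_left (le_trans (le_of_eq ?_)
    (block_pos (q := (∑ l, if f l then (1 : ℝ) else 0) / 13) h1)) (by norm_num)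
  congr 1
  field_simp
  ring

lemma sum_block_neg {δ : ℝ} (h0 : 0 < δ) (h1 : δ < 1) (f : Fin 13 → Bool) :
    ∑ a, Real.exp (-∑ l, (if l = 0 then Real.log (1 + δ) - Real.log (1 - δ) - 2 * δ / 13
      else -(2 * δ / 13)) * (if f (l + a) then (1 : ℝ) else 0)) ≤
      13 * (Real.exp δ / (1 + δ)) := by
  have hd : 1 - δ ≠ 0 := by linarith
  have hd' : 1 + δ ≠ 0 := by linarith
  have h2 : ∀ (a : Fin 13) (G : ℝ), -(if f a then G else 0) = if f a then -G else 0 := by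
    intro a G; split_ifs <;> simp
  simp_rw [sum_fin_shift, neg_sub, sub_eq_add_neg (2 * δ * _), h2, Real.exp_add]
  rw [← Finset.mul_sum, sum_exp_ite, Real.exp_neg, exp_logRatio h0 h1,
    mul_left_comm]
  refine mul_le_mul_of_nonneg_left (le_trans (le_of_eq ?_)
    (block_neg (q := (∑ l, if f l then (1 : ℝ) else 0) / 13) h0)) (by norm_num)
  rw [mul_comm]
  congr 1
  field_simp
  ring

/-- The sum over all cyclic shifts factorizes over the blocks. -/
lemma sum_shift_eq_prod {J : Type*} [Fintype J] [DecidableEq J] (g : J → Fin 13 → ℝ) :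
    ∑ κ : J → Fin 13, Real.exp (∑ j, g j (κ j)) = ∏ j, ∑ a, Real.exp (g j a) := by
  rw [Finset.prod_univ_sum, Fintype.piFinset_univ]
  exact Finset.sum_congr rfl fun κ _ => Real.exp_sum _ _

/-- The factors `exp (-δ)` and `exp δ` of the two samples cancel, which is why the samples must have
equal size. -/
lemma prod_block_eq {m : ℕ} {δ : ℝ} :
    (13 * (Real.exp (-δ) / (1 - δ))) ^ m * (13 * (Real.exp δ / (1 + δ))) ^ m =
      13 ^ (m + m) * ((1 - δ ^ 2)⁻¹) ^ m := by
  rw [← mul_pow, pow_add, ← mul_pow, ← mul_pow, Real.exp_neg]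
  congr 1
  have : (1 - δ ^ 2) = (1 - δ) * (1 + δ) := by ring
  rw [this, mul_inv]
  have := (Real.exp_pos δ).ne'
  field_simp

lemma sum_pool {m : ℕ} (δ : ℝ) (t : (Fin m ⊕ Fin m) × Fin 13 → Bool) :
    ∑ p, poolWeight δ p * (if t p then (1 : ℝ) else 0) =
      ∑ j : Fin m ⊕ Fin m, Sum.elim (fun _ => (1 : ℝ)) (fun _ => -1) j *
        ∑ l, (if l = 0 then Real.log (1 + δ) - Real.log (1 - δ) - 2 * δ / 13
          else -(2 * δ / 13)) * (if t (j, l) then (1 : ℝ) else 0) := by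
  rw [Fintype.sum_prod_type]
  refine Finset.sum_congr rfl fun j _ => ?_
  rw [Finset.mul_sum]
  exact Finset.sum_congr rfl fun l _ => by rw [poolWeight, mul_assoc]

/-- The two exponentials come from removing the absolute value. Negating the statistic exchanges the
two samples, so both obey the same bound. -/
lemma sum_shift_exp_le {m : ℕ} {δ : ℝ} (h0 : 0 < δ) (h1 : δ < 1)
    (t : (Fin m ⊕ Fin m) × Fin 13 → Bool) :
    ∑ κ : Fin m ⊕ Fin m → Fin 13,
      (Real.exp (∑ p, poolWeight δ p * (if t (p.1, p.2 + κ p.1) then (1 : ℝ) else 0)) +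
       Real.exp (-∑ p, poolWeight δ p * (if t (p.1, p.2 + κ p.1) then (1 : ℝ) else 0))) ≤
      2 * (13 ^ (m + m) * ((1 - δ ^ 2)⁻¹) ^ m) := by
  have hpos : 0 < 1 - δ := by linarith
  have e : ∀ κ : Fin m ⊕ Fin m → Fin 13,
      ∑ p, poolWeight δ p * (if t (p.1, p.2 + κ p.1) then (1 : ℝ) else 0) = _ :=
    fun κ => sum_pool δ fun p => t (p.1, p.2 + κ p.1)
  rw [Finset.sum_add_distrib, two_mul]
  refine add_le_add ?_ ?_
  · simp_rw [e]
    rw [sum_shift_eq_prod (fun j a => Sum.elim (fun _ => (1 : ℝ)) (fun _ => -1) j *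
        ∑ l, (if l = 0 then Real.log (1 + δ) - Real.log (1 - δ) - 2 * δ / 13
          else -(2 * δ / 13)) * (if t (j, l + a) then (1 : ℝ) else 0)), Fintype.prod_sum_type,
      ← prod_block_eq]
    simp only [Sum.elim_inl, Sum.elim_inr, one_mul, neg_one_mul]
    have hc : ∀ b : ℝ, b ^ m = ∏ _j : Fin m, b := by simp
    rw [hc, hc]
    refine mul_le_mul (Finset.prod_le_prod (fun _ _ => by positivity) fun j _ =>
      sum_block_pos h0 h1 fun l => t (Sum.inl j, l)) (Finset.prod_le_prod (fun _ _ => by positivity)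
        fun j _ => sum_block_neg h0 h1 fun l => t (Sum.inr j, l)) (by positivity) (by positivity)
  · simp_rw [e, ← Finset.sum_neg_distrib]
    rw [sum_shift_eq_prod (fun j a => -(Sum.elim (fun _ => (1 : ℝ)) (fun _ => -1) j *
        ∑ l, (if l = 0 then Real.log (1 + δ) - Real.log (1 - δ) - 2 * δ / 13
          else -(2 * δ / 13)) * (if t (j, l + a) then (1 : ℝ) else 0))), Fintype.prod_sum_type,
      ← prod_block_eq, mul_comm]
    simp only [Sum.elim_inl, Sum.elim_inr, one_mul, neg_one_mul, neg_neg]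
    have hc : ∀ b : ℝ, b ^ m = ∏ _j : Fin m, b := by simp
    rw [hc, hc]
    refine mul_le_mul (Finset.prod_le_prod (fun _ _ => by positivity) fun j _ =>
      sum_block_pos h0 h1 fun l => t (Sum.inr j, l)) (Finset.prod_le_prod (fun _ _ => by positivity)
        fun j _ => sum_block_neg h0 h1 fun l => t (Sum.inl j, l)) (by positivity) (by positivity)

/-- The label vectors are those of the unshifted `z`, so the index set of the sum does not depend on
`σ` and can be exchanged with the sum over shifts. -/
lemma exp_supSum_le {ι : Type*} [Fintype ι] [DecidableEq ι] {H : Set (X → Bool)}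
    (hne : H.Nonempty) (w : ι → ℝ) (z : ι → X) (σ : ι → ι) :
    Real.exp (supSum H w (z ∘ σ)) ≤ ∑ t ∈ traces H z,
      (Real.exp (∑ p, w p * (if t (σ p) then 1 else 0)) +
        Real.exp (-∑ p, w p * (if t (σ p) then 1 else 0))) := by
  obtain ⟨h, hh, he⟩ := exists_supSum_eq w (z ∘ σ) hne
  rw [he]
  refine (exp_abs_le _).trans ?_
  exact Finset.single_le_sum (f := fun t : ι → Bool =>
    (Real.exp (∑ p, w p * (if t (σ p) then 1 else 0)) +
        Real.exp (-∑ p, w p * (if t (σ p) then 1 else 0)))) (fun _ _ => by positivity)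
    (mem_traces.2 ⟨h, hh, rfl⟩)

/-- Symmetrization of the pool by cyclic shifts within each block. -/
lemma sum_shift_exp_supSum_le {m : ℕ} {δ : ℝ} (h0 : 0 < δ) (h1 : δ < 1) {H : Set (X → Bool)}
    {d : ℕ} (hVC : HasVCDim H d) (hdm : d ≤ m) (z : (Fin m ⊕ Fin m) × Fin 13 → X) :
    ∑ κ : Fin m ⊕ Fin m → Fin 13,
      Real.exp (supSum H (poolWeight δ) (z ∘ fun p => (p.1, p.2 + κ p.1))) ≤
      13 ^ (m + m) *
        (2 * ((1 - δ ^ 2)⁻¹) ^ m * (Real.exp 1 * (26 * m) / d) ^ d) := by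
  have hpos : 0 < 1 - δ ^ 2 := by nlinarith
  have hT : ((traces H z).card : ℝ) ≤ (Real.exp 1 * (26 * m) / d) ^ d := by
    have h2 := card_traces_le hVC z
    have h3 : Fintype.card ((Fin m ⊕ Fin m) × Fin 13) = 26 * m := by simp; ring
    rw [h3] at h2
    have h4 := sum_choose_le (n := 26 * m) (d := d) (by omega)
    push_cast at h4
    refine le_trans ?_ h4
    exact_mod_cast h2
  calc _ ≤ ∑ κ : Fin m ⊕ Fin m → Fin 13, ∑ t ∈ traces H z, _ :=
        Finset.sum_le_sum fun κ _ => exp_supSum_le hVC.nonempty _ _ _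
    _ = ∑ t ∈ traces H z, ∑ κ : Fin m ⊕ Fin m → Fin 13, _ := Finset.sum_comm
    _ ≤ ∑ t ∈ traces H z, 2 * (13 ^ (m + m) * ((1 - δ ^ 2)⁻¹) ^ m) :=
        Finset.sum_le_sum fun t _ => sum_shift_exp_le h0 h1 t
    _ = (traces H z).card * (2 * (13 ^ (m + m) * ((1 - δ ^ 2)⁻¹) ^ m)) := by simp
    _ ≤ (Real.exp 1 * (26 * m) / d) ^ d * (2 * (13 ^ (m + m) * ((1 - δ ^ 2)⁻¹) ^ m)) := by
        gcongr
    _ = _ := by ring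

/-! ### Laws of the samples and of the pool -/

variable [MeasurableSpace X]

lemma measurePreserving_reindex {ι ι' : Type*} [Fintype ι] [Fintype ι'] (e : ι' ≃ ι)
    (P : ι → Measure X) [∀ i, IsProbabilityMeasure (P i)] :
    MeasurePreserving (fun (z : ι → X) i => z (e i)) (Measure.pi P) (Measure.pi fun i => P (e i)) :=
  (measurePreserving_piCongrLeft P e).symm

lemma IsMeasurableClass.aemeasurable_supSum {H : Set (X → Bool)} {𝒟 : Set (Measure X)}
    (hH : IsMeasurableClass H 𝒟) {ι : Type*} [Fintype ι] (P : ι → Measure X)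
    [∀ i, IsProbabilityMeasure (P i)] (hP : ∀ i, P i ∈ 𝒟) (w : ι → ℝ) :
    AEMeasurable (supSum H w) (Measure.pi P) := by
  let e := (Fintype.equivFin ι).symm
  have h1 := (hH.aemeasurable_iSup _ (fun i => P (e i)) (fun i => hP _) fun i => w (e i))
  have h2 := h1.comp_quasiMeasurePreserving (measurePreserving_reindex e P).quasiMeasurePreserving
  refine h2.congr (Filter.Eventually.of_forall fun z => ?_)
  simp only [Function.comp_apply, supSum]
  congr 1
  funext h
  congr 1
  exact Fintype.sum_equiv e _ _ fun _ => rfl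

/-- Assemble the pool from the real sample and the ghost samples. -/
def assemble {J : Type*} (q : (J → X) × (J × Fin 12 → X)) (p : J × Fin 13) : X :=
  Fin.cases (q.1 p.1) (fun l => q.2 (p.1, l)) p.2

omit [MeasurableSpace X] in
@[simp] lemma assemble_zero {J : Type*} (q : (J → X) × (J × Fin 12 → X)) (j : J) :
    assemble q (j, 0) = q.1 j := rfl

omit [MeasurableSpace X] in
@[simp] lemma assemble_succ {J : Type*} (q : (J → X) × (J × Fin 12 → X)) (j : J) (l : Fin 12) :
    assemble q (j, l.succ) = q.2 (j, l) := rfl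

lemma measurePreserving_assemble {J : Type*} [Fintype J] (Q : J → Measure X)
    [∀ j, IsProbabilityMeasure (Q j)] :
    MeasurePreserving assemble
      ((Measure.pi Q).prod (Measure.pi fun p : J × Fin 12 => Q p.1))
      (Measure.pi fun p : J × Fin 13 => Q p.1) := by
  have hm : Measurable (assemble : (J → X) × (J × Fin 12 → X) → J × Fin 13 → X) := by
    refine measurable_pi_iff.2 ?_
    rintro ⟨j, l⟩
    refine Fin.cases ?_ (fun l => ?_) l
    · exact (measurable_pi_apply j).comp measurable_fst
    · exact (measurable_pi_apply (j, l)).comp measurable_snd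
  refine ⟨hm, (Measure.pi_eq fun s hs => ?_).symm⟩
  rw [Measure.map_apply hm (MeasurableSet.univ_pi hs)]
  have : assemble ⁻¹' (Set.univ.pi s) = (Set.univ.pi fun j => s (j, 0)) ×ˢ
      (Set.univ.pi fun p : J × Fin 12 => s (p.1, p.2.succ)) := by
    ext q
    simp only [Set.mem_preimage, Set.mem_pi, Set.mem_univ, true_implies, Set.mem_prod, Prod.forall,
      Fin.forall_fin_succ (n := 12), assemble_zero, assemble_succ]
    exact forall_and
  rw [this, Measure.prod_prod, Measure.pi_pi, Measure.pi_pi, Fintype.prod_prod_type,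
    Fintype.prod_prod_type, ← Finset.prod_mul_distrib]
  exact Finset.prod_congr rfl fun j _ => (Fin.prod_univ_succ fun l => Q j (s (j, l))).symm

/-- Jensen's inequality for `exp`. -/
lemma ofReal_exp_integral_le {α : Type*} [MeasurableSpace α] (ν : Measure α)
    [IsProbabilityMeasure ν] {Y : α → ℝ} (hY : Measurable Y) {C : ℝ} (hC : ∀ a, |Y a| ≤ C) :
    ENNReal.ofReal (Real.exp (∫ a, Y a ∂ν)) ≤ ∫⁻ a, ENNReal.ofReal (Real.exp (Y a)) ∂ν := by
  have h1 : Integrable Y ν :=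
    Integrable.of_bound hY.aestronglyMeasurable C (Filter.Eventually.of_forall hC)
  have h2 : Integrable (fun a => Real.exp (Y a)) ν := by
    refine Integrable.of_bound (by fun_prop) (Real.exp C) (Filter.Eventually.of_forall fun a => ?_)
    rw [Real.norm_eq_abs, Real.abs_exp]
    exact Real.exp_le_exp.2 ((le_abs_self _).trans (hC a))
  rw [← ofReal_integral_eq_lintegral_ofReal h2
    (Filter.Eventually.of_forall fun a => (Real.exp_pos _).le)]
  exact ENNReal.ofReal_le_ofReal (convexOn_exp.map_integral_le Real.continuous_exp.continuousOn
    isClosed_univ (by simp) h1 h2)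

/-- The supremum over the supports of hypotheses of the difference of two measures. -/
noncomputable def supDiff (H : Set (X → Bool)) (D D' : Measure X) : ℝ :=
  ⨆ A : supports H, |D.real (A : Set X) - D'.real (A : Set X)|

section supDiff

variable {H : Set (X → Bool)} (D D' : Measure X) [IsProbabilityMeasure D] [IsProbabilityMeasure D']

lemma abs_measureReal_sub_le_one (A : Set X) : |D.real A - D'.real A| ≤ 1 := by
  rw [abs_le]
  constructor <;> linarith [measureReal_nonneg (μ := D) (s := A), measureReal_le_one (μ := D) (s := A),
    measureReal_nonneg (μ := D') (s := A), measureReal_le_one (μ := D') (s := A)]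

lemma bddAbove_abs_measureReal_sub :
    BddAbove (Set.range fun A : supports H => |D.real (A : Set X) - D'.real (A : Set X)|) :=
  ⟨1, by rintro _ ⟨A, rfl⟩; exact abs_measureReal_sub_le_one D D' _⟩

lemma abs_measureReal_sub_le_supDiff {h : X → Bool} (hh : h ∈ H) :
    |D.real (h ⁻¹' {true}) - D'.real (h ⁻¹' {true})| ≤ supDiff H D D' :=
  le_ciSup (bddAbove_abs_measureReal_sub (H := H) D D') (⟨_, h, hh, rfl⟩ : supports H)

omit [IsProbabilityMeasure D] [IsProbabilityMeasure D'] in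
lemma supDiff_nonneg : 0 ≤ supDiff H D D' := Real.iSup_nonneg fun _ => abs_nonneg _

lemma supDiff_le_one : supDiff H D D' ≤ 1 :=
  Real.iSup_le (fun _ => abs_measureReal_sub_le_one D D' _) zero_le_one

end supDiff

lemma integral_label {h : X → Bool} (hm : Measurable h) (D : Measure X) :
    ∫ x, (if h x then (1 : ℝ) else 0) ∂D = D.real (h ⁻¹' {true}) := by
  have : (fun x => if h x then (1 : ℝ) else 0) = (h ⁻¹' {true}).indicator 1 := by
    funext x; simp [Set.indicator]
  rw [this, integral_indicator_one (hm (by simp))]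

/-- The sign of a sample point: `+1` for the target sample, `-1` for the source sample. -/
noncomputable def sampleSign {m : ℕ} : Fin m ⊕ Fin m → ℝ := Sum.elim (fun _ => 1) (fun _ => -1)

lemma two_mul_le_logRatio {δ : ℝ} (h0 : 0 < δ) (h1 : δ < 1) :
    2 * δ ≤ Real.log (1 + δ) - Real.log (1 - δ) := by
  have ha := Real.hasSum_log_sub_log_of_abs_lt_one (x := δ) (by rw [abs_of_pos h0]; exact h1)
  refine le_trans (le_of_eq ?_) (sum_le_hasSum (Finset.range 1) (fun _ _ => by positivity) ha)
  simp

lemma poolWeight_zero {m : ℕ} (δ : ℝ) (j : Fin m ⊕ Fin m) : poolWeight δ (j, 0) =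
    sampleSign j * (Real.log (1 + δ) - Real.log (1 - δ) - 2 * δ / 13) := by
  simp [poolWeight, sampleSign]

lemma poolWeight_succ {m : ℕ} (δ : ℝ) (j : Fin m ⊕ Fin m) (l : Fin 12) :
    poolWeight δ (j, l.succ) = sampleSign j * -(2 * δ / 13) := by
  simp [poolWeight, sampleSign, Fin.succ_ne_zero]

omit [MeasurableSpace X] in
lemma sum_pool_assemble {m : ℕ} (δ : ℝ) (h : X → Bool)
    (q : (Fin m ⊕ Fin m → X) × ((Fin m ⊕ Fin m) × Fin 12 → X)) :
    ∑ p, poolWeight δ p * (if h (assemble q p) then (1 : ℝ) else 0) =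
      (Real.log (1 + δ) - Real.log (1 - δ) - 2 * δ / 13) *
        ∑ j, sampleSign j * (if h (q.1 j) then 1 else 0) +
      ∑ p, -(2 * δ / 13) * (sampleSign p.1 * (if h (q.2 p) then 1 else 0)) := by
  rw [Fintype.sum_prod_type, Fintype.sum_prod_type, Finset.mul_sum, ← Finset.sum_add_distrib]
  refine Finset.sum_congr rfl fun j _ => ?_
  rw [Fin.sum_univ_succ]
  congr 1
  · rw [assemble_zero, poolWeight_zero]; ring
  · refine Finset.sum_congr rfl fun l _ => ?_
    rw [assemble_succ, poolWeight_succ]; ring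

lemma integral_label_comp_eval {ι : Type*} [Fintype ι] (P : ι → Measure X)
    [∀ i, IsProbabilityMeasure (P i)] {h : X → Bool} (hm : Measurable h) (i : ι) :
    ∫ y : ι → X, (if h (y i) then (1 : ℝ) else 0) ∂Measure.pi P = (P i).real (h ⁻¹' {true}) := by
  rw [← integral_label hm]
  exact integral_comp_eval (μ := P) (f := fun x => if h x then (1 : ℝ) else 0)
    (Measurable.ite (hm (measurableSet_singleton true)) measurable_const
      measurable_const).aestronglyMeasurable

lemma measurable_label {α : Type*} [MeasurableSpace α] {h : X → Bool} (hm : Measurable h)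
    {g : α → X} (hg : Measurable g) : Measurable fun a => if h (g a) then (1 : ℝ) else 0 :=
  Measurable.ite ((hm.comp hg) (measurableSet_singleton true)) measurable_const measurable_const

/-- The two laws of the sample points. -/
def sampleLaw {m : ℕ} (D D' : Measure X) : Fin m ⊕ Fin m → Measure X :=
  Sum.elim (fun _ => D) (fun _ => D')

instance {m : ℕ} (D D' : Measure X) [IsProbabilityMeasure D] [IsProbabilityMeasure D']
    (j : Fin m ⊕ Fin m) : IsProbabilityMeasure (sampleLaw D D' j) := by
  rcases j with j | j <;> simp only [sampleLaw, Sum.elim_inl, Sum.elim_inr] <;> infer_instance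

/-! ### The upper tail -/

section pool

variable {H : Set (X → Bool)} {D D' : Measure X} [IsProbabilityMeasure D] [IsProbabilityMeasure D']

/-- For a sample with a large deviation, averaging over the ghosts keeps the exponential of the
pool statistic large. -/
lemma le_lintegral_ghost {m : ℕ} {δ : ℝ} (h0 : 0 < δ) (h1 : δ < 1) (hne : H.Nonempty)
    (hmeas : ∀ h ∈ H, Measurable h) {x : Fin m ⊕ Fin m → X}
    (hx : m * (supDiff H D D' + δ) ≤ supSum H sampleSign x) :
    ENNReal.ofReal (Real.exp (m * δ * (Real.log (1 + δ) - Real.log (1 - δ) - 2 * δ / 13))) ≤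
      ∫⁻ y, ENNReal.ofReal (Real.exp (supSum H (poolWeight δ) (assemble (x, y))))
        ∂(Measure.pi fun p : (Fin m ⊕ Fin m) × Fin 12 => sampleLaw D D' p.1) := by
  -- The maximizer and its sign depend on the real sample only, so they stay fixed while the ghosts
  -- are integrated out.
  obtain ⟨h, hh, hmax⟩ := exists_supSum_eq sampleSign x hne
  set A := ∑ j, sampleSign j * (if h (x j) then (1 : ℝ) else 0) with hA
  obtain ⟨c, hc, hcA⟩ : ∃ c : ℝ, |c| = 1 ∧ c * A = |A| := by
    rcases abs_cases A with ⟨e, -⟩ | ⟨e, -⟩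
    · exact ⟨1, by simp, by rw [e]; ring⟩
    · exact ⟨-1, by simp, by rw [e]; ring⟩
  set G := Real.log (1 + δ) - Real.log (1 - δ) with hG
  have hG2 : 2 * δ ≤ G := two_mul_le_logRatio h0 h1
  let Y : ((Fin m ⊕ Fin m) × Fin 12 → X) → ℝ := fun y =>
    c * ∑ p, poolWeight δ p * (if h (assemble (x, y) p) then (1 : ℝ) else 0)
  have hYeq : Y = fun y => c * ((G - 2 * δ / 13) * A) +
      ∑ p, c * (-(2 * δ / 13) * (sampleSign p.1 * (if h (y p) then 1 else 0))) := by
    funext y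
    simp only [Y, sum_pool_assemble, ← hG, mul_add, Finset.mul_sum, hA]
  have hYm : Measurable Y := by
    rw [hYeq]
    refine measurable_const.add (Finset.measurable_fun_sum _ fun p _ => ?_)
    exact (((measurable_label (hmeas h hh) (measurable_pi_apply p)).const_mul _).const_mul _).const_mul _
  have hYC : ∀ y, |Y y| ≤ ∑ p : (Fin m ⊕ Fin m) × Fin 13, |poolWeight δ p| := by
    intro y
    simp only [Y]
    rw [abs_mul, hc, one_mul]
    refine (Finset.abs_sum_le_sum_abs _ _).trans (Finset.sum_le_sum fun p _ => ?_)
    split_ifs <;> simp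
  have hYV : ∀ y, Y y ≤ supSum H (poolWeight δ) (assemble (x, y)) := by
    intro y
    refine le_trans (le_trans (le_abs_self _) ?_) (abs_sum_le_supSum (poolWeight δ) _ hh)
    simp only [Y]
    rw [abs_mul, hc, one_mul]
  have hYint : ∫ y, Y y ∂(Measure.pi fun p : (Fin m ⊕ Fin m) × Fin 12 => sampleLaw D D' p.1) =
      (G - 2 * δ / 13) * |A| - 12 * (2 * δ / 13) * (m *
        (c * (D.real (h ⁻¹' {true}) - D'.real (h ⁻¹' {true})))) := by
    have hint : ∀ p : (Fin m ⊕ Fin m) × Fin 12, Integrable (fun y : (Fin m ⊕ Fin m) × Fin 12 → X =>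
        if h (y p) then (1 : ℝ) else 0)
        (Measure.pi fun p : (Fin m ⊕ Fin m) × Fin 12 => sampleLaw D D' p.1) := fun p =>
      Integrable.of_bound (measurable_label (hmeas h hh) (measurable_pi_apply p)).aestronglyMeasurable
        1 (Filter.Eventually.of_forall fun y => by split_ifs <;> simp)
    have hint' := fun p => (((hint p).const_mul (sampleSign p.1)).const_mul
      (-(2 * δ / 13))).const_mul c
    rw [hYeq, integral_add (integrable_const _) (integrable_finsetSum _ fun p _ => hint' p),
      integral_finsetSum _ fun p _ => hint' p]
    simp_rw [integral_const, probReal_univ, one_smul, integral_const_mul, integral_label_comp_eval _ (hmeas h hh)]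
    rw [← hcA, Fintype.sum_prod_type, Fintype.sum_sum_type]
    simp [sampleLaw, sampleSign]
    ring
  refine le_trans (ENNReal.ofReal_le_ofReal (Real.exp_le_exp.2 ?_))
    ((ofReal_exp_integral_le _ hYm hYC).trans (lintegral_mono fun y =>
      ENNReal.ofReal_le_ofReal (Real.exp_le_exp.2 (hYV y))))
  rw [hYint]
  have hs : c * (D.real (h ⁻¹' {true}) - D'.real (h ⁻¹' {true})) ≤ supDiff H D D' := by
    refine le_trans (le_trans (le_abs_self _) ?_) (abs_measureReal_sub_le_supDiff D D' hh)
    rw [abs_mul, hc, one_mul]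
  rw [hmax] at hx
  have hs0 : 0 ≤ supDiff H D D' := supDiff_nonneg D D'
  have e1 : (G - 2 * δ / 13) * (m * (supDiff H D D' + δ)) ≤ (G - 2 * δ / 13) * |A| := by
    gcongr; linarith
  have e2 : 12 * (2 * δ / 13) * (m * (c * (D.real (h ⁻¹' {true}) - D'.real (h ⁻¹' {true})))) ≤
      12 * (2 * δ / 13) * (m * supDiff H D D') := by gcongr
  -- With `s` the true supremum, the mean is at least `(G - 2δ/13) m (s + δ) - (24δ/13) m s = mδ (G
  -- - 2δ/13) + (G - 2δ) m s`, and `G ≥ 2δ`.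
  have e3 : 0 ≤ (G - 2 * δ) * (m * supDiff H D D') :=
    mul_nonneg (by linarith) (by positivity)
  linarith

/-- The exponential moment of the pool statistic. -/
lemma lintegral_exp_pool_le {m d : ℕ} {δ : ℝ} (h0 : 0 < δ) (h1 : δ < 1) (hVC : HasVCDim H d)
    (hdm : d ≤ m) {𝒟 : Set (Measure X)} (hH : IsMeasurableClass H 𝒟) (hD : D ∈ 𝒟) (hD' : D' ∈ 𝒟) :
    ∫⁻ z, ENNReal.ofReal (Real.exp (supSum H (poolWeight δ) z))
        ∂(Measure.pi fun p : (Fin m ⊕ Fin m) × Fin 13 => sampleLaw D D' p.1) ≤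
      ENNReal.ofReal (2 * ((1 - δ ^ 2)⁻¹) ^ m * (Real.exp 1 * (26 * m) / d) ^ d) := by
  set ν := Measure.pi fun p : (Fin m ⊕ Fin m) × Fin 13 => sampleLaw D D' p.1
  set f : ((Fin m ⊕ Fin m) × Fin 13 → X) → ENNReal := fun z =>
    ENNReal.ofReal (Real.exp (supSum H (poolWeight δ) z)) with hf
  have hfm : AEMeasurable f ν := by
    refine (hH.aemeasurable_supSum _ (fun p => ?_) _).exp.ennreal_ofReal
    rcases p with ⟨j | j, l⟩
    exacts [hD, hD']
  let e : (Fin m ⊕ Fin m → Fin 13) → ((Fin m ⊕ Fin m) × Fin 13 ≃ (Fin m ⊕ Fin m) × Fin 13) :=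
    fun κ => Equiv.prodShear (Equiv.refl _) fun j => Equiv.addRight (κ j)
  have hpres : ∀ κ, MeasurePreserving (fun (z : (Fin m ⊕ Fin m) × Fin 13 → X) p => z (e κ p)) ν ν :=
    fun κ => measurePreserving_reindex (e κ) fun p => sampleLaw D D' p.1
  have hcomp : ∀ κ, ∫⁻ z, f (z ∘ e κ) ∂ν = ∫⁻ z, f z ∂ν := fun κ => by
    conv_rhs => rw [← (hpres κ).map_eq]
    rw [lintegral_map' (by rw [(hpres κ).map_eq]; exact hfm) (hpres κ).aemeasurable]
    rfl
  -- Each shift permutes points with the same law, so all `13 ^ (m + m)` integrals agree; the sum is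
  -- then bounded pointwise.
  have hsum : (13 : ENNReal) ^ (m + m) * ∫⁻ z, f z ∂ν = ∫⁻ z, ∑ κ, f (z ∘ e κ) ∂ν := by
    have : ∫⁻ z, ∑ κ, f (z ∘ e κ) ∂ν = ∑ κ, ∫⁻ z, f (z ∘ e κ) ∂ν := lintegral_finsetSum' _
      fun κ _ => hfm.comp_quasiMeasurePreserving (hpres κ).quasiMeasurePreserving
    rw [this, Finset.sum_congr rfl fun κ _ => hcomp κ]
    simp
  have hle : (13 : ENNReal) ^ (m + m) * ∫⁻ z, f z ∂ν ≤ 13 ^ (m + m) *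
      ENNReal.ofReal (2 * ((1 - δ ^ 2)⁻¹) ^ m * (Real.exp 1 * (26 * m) / d) ^ d) := by
    rw [hsum]
    have h13 : (13 : ENNReal) ^ (m + m) = ENNReal.ofReal (13 ^ (m + m)) := by
      rw [ENNReal.ofReal_pow (by norm_num)]; norm_num
    rw [h13, ← ENNReal.ofReal_mul (by positivity)]
    refine (lintegral_mono (g := fun _ => _) fun z => ?_).trans (by rw [lintegral_const, measure_univ, mul_one])
    simp only [hf]
    rw [← ENNReal.ofReal_sum_of_nonneg fun _ _ => (Real.exp_pos _).le]
    exact ENNReal.ofReal_le_ofReal (sum_shift_exp_supSum_le h0 h1 hVC hdm z)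
  exact (ENNReal.mul_le_mul_iff_right (by positivity) (by finiteness)).1 hle

/-- The tail bound with the enlarged pool. -/
lemma pi_supSum_ge_le {m d : ℕ} {δ : ℝ} (h0 : 0 < δ) (h1 : δ < 1) (hVC : HasVCDim H d)
    (hdm : d ≤ m) {𝒟 : Set (Measure X)} (hH : IsMeasurableClass H 𝒟) (hD : D ∈ 𝒟) (hD' : D' ∈ 𝒟) :
    (Measure.pi (sampleLaw D D' : Fin m ⊕ Fin m → Measure X)).real
      {x | m * (supDiff H D D' + δ) ≤ supSum H sampleSign x} ≤
      2 * ((Real.exp 1 * (26 * m) / d) ^ d * Real.exp (-(m * (δ * (Real.log (1 + δ) -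
        Real.log (1 - δ)) + Real.log (1 - δ ^ 2) - 2 / 13 * δ ^ 2)))) := by
  set ν := Measure.pi (sampleLaw D D' : Fin m ⊕ Fin m → Measure X)
  set B := Real.exp (m * δ * (Real.log (1 + δ) - Real.log (1 - δ) - 2 * δ / 13)) with hB
  have hpos : 0 < 1 - δ ^ 2 := by nlinarith
  have hpres := measurePreserving_assemble (sampleLaw D D' : Fin m ⊕ Fin m → Measure X)
  have hfm : AEMeasurable (fun z => ENNReal.ofReal (Real.exp (supSum H (poolWeight δ) z)))
      (Measure.pi fun p : (Fin m ⊕ Fin m) × Fin 13 => sampleLaw D D' p.1) := by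
    refine (hH.aemeasurable_supSum _ (fun p => ?_) _).exp.ennreal_ofReal
    rcases p with ⟨j | j, l⟩
    exacts [hD, hD']
  have hfm' := hfm.comp_quasiMeasurePreserving hpres.quasiMeasurePreserving
  have h2 := lintegral_exp_pool_le h0 h1 hVC hdm hH hD hD'
  have hprod := lintegral_prod _ hfm'
  simp only [Function.comp_apply] at hprod
  rw [← hpres.map_eq, lintegral_map' (by rw [hpres.map_eq]; exact hfm) hpres.aemeasurable,
    hprod] at h2
  -- Markov's inequality for the ghost average, whose superlevel set contains the deviation event;
  -- the latter need not be measurable.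
  have h3 := mul_meas_ge_le_lintegral₀ hfm'.lintegral_prod_right' (ENNReal.ofReal B)
  have hsub : {x : Fin m ⊕ Fin m → X | m * (supDiff H D D' + δ) ≤ supSum H sampleSign x} ⊆
      {x | ENNReal.ofReal B ≤ _} := fun x hx =>
    le_lintegral_ghost (D := D) (D' := D') h0 h1 hVC.nonempty hH.measurable hx
  have h4 := (mul_le_mul_right (measure_mono hsub) (ENNReal.ofReal B)).trans (h3.trans h2)
  have h5 := ENNReal.toReal_mono ENNReal.ofReal_ne_top h4
  rw [ENNReal.toReal_mul, ENNReal.toReal_ofReal (by positivity), ENNReal.toReal_ofReal (by positivity),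
    ← measureReal_def] at h5
  have h6 : Real.exp (-(m * (δ * (Real.log (1 + δ) -
        Real.log (1 - δ)) + Real.log (1 - δ ^ 2) - 2 / 13 * δ ^ 2))) = ((1 - δ ^ 2)⁻¹) ^ m / B := by
    have : ((1 - δ ^ 2)⁻¹) ^ m = Real.exp (m * -Real.log (1 - δ ^ 2)) := by
      rw [Real.exp_nat_mul, Real.exp_neg, Real.exp_log hpos]
    rw [this, hB, ← Real.exp_sub]
    congr 1
    ring
  rw [h6]
  have hB0 : 0 < B := Real.exp_pos _
  have h7 : 2 * ((Real.exp 1 * (26 * m) / d) ^ d * (((1 - δ ^ 2)⁻¹) ^ m / B)) =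
    (2 * ((1 - δ ^ 2)⁻¹) ^ m * (Real.exp 1 * (26 * m) / d) ^ d) / B := by ring
  rw [h7, le_div_iff₀ hB0, mul_comm]
  exact h5

end pool

lemma pi_supSum_ge_le_of_lt_one {H : Set (X → Bool)} {D D' : Measure X} [IsProbabilityMeasure D]
    [IsProbabilityMeasure D'] {m d : ℕ} {δ : ℝ} (h0 : 0 < δ) (h1 : δ < 1) (hVC : HasVCDim H d)
    (hdm : d ≤ m) {𝒟 : Set (Measure X)} (hH : IsMeasurableClass H 𝒟) (hD : D ∈ 𝒟) (hD' : D' ∈ 𝒟) :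
    (Measure.pi (sampleLaw D D' : Fin m ⊕ Fin m → Measure X)).real
      {x | m * (supDiff H D D' + δ) ≤ supSum H sampleSign x} ≤
      2 * ((Real.exp 1 * m / d) ^ d * Real.exp (-(m * δ ^ 2 / 2))) := by
  rcases le_or_gt (d * (1 + Real.log (m / d))) (m * δ ^ 2 / 2) with h | h
  · refine (pi_supSum_ge_le h0 h1 hVC hdm hH hD hD').trans ?_
    gcongr 2 * ?_
    exact pool_bound_le hdm h0 h1 h
  · have := one_le_bound_of_lt hdm h
    have h2 : (Measure.pi (sampleLaw D D' : Fin m ⊕ Fin m → Measure X)).real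
      {x | m * (supDiff H D D' + δ) ≤ supSum H sampleSign x} ≤ 1 := measureReal_le_one
    linarith

/-- The upper tail of the supremum of the empirical differences. -/
lemma pi_supSum_ge_le_of_le_one {H : Set (X → Bool)} {D D' : Measure X} [IsProbabilityMeasure D]
    [IsProbabilityMeasure D'] {m d : ℕ} {δ : ℝ} (h0 : 0 < δ) (h1 : δ ≤ 1) (hVC : HasVCDim H d)
    (hdm : d ≤ m) {𝒟 : Set (Measure X)} (hH : IsMeasurableClass H 𝒟) (hD : D ∈ 𝒟) (hD' : D' ∈ 𝒟) :
    (Measure.pi (sampleLaw D D' : Fin m ⊕ Fin m → Measure X)).real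
      {x | m * (supDiff H D D' + δ) ≤ supSum H sampleSign x} ≤
      2 * ((Real.exp 1 * m / d) ^ d * Real.exp (-(m * δ ^ 2 / 2))) := by
  have hcont : Continuous fun t : ℝ =>
      2 * ((Real.exp 1 * m / d) ^ d * Real.exp (-(m * t ^ 2 / 2))) := by fun_prop
  -- At `δ = 1` the weight `log (1 - δ)` degenerates, so this endpoint is a limit from the left.
  refine ge_of_tendsto ((hcont.tendsto δ).mono_left nhdsWithin_le_nhds : Filter.Tendsto _
    (nhdsWithin δ (Set.Iio δ)) _) ?_
  filter_upwards [Ioo_mem_nhdsLT h0] with t ht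
  refine (measureReal_mono fun x hx => ?_).trans
    (pi_supSum_ge_le_of_lt_one ht.1 (ht.2.trans_le h1) hVC hdm hH hD hD')
  simp only [Set.mem_ofPred_eq] at hx ⊢
  refine le_trans ?_ hx
  gcongr
  exact ht.2.le

/-! ### The lower tail -/

/-- A Hoeffding bound for a single hypothesis. -/
lemma pi_single_le {D D' : Measure X} [IsProbabilityMeasure D] [IsProbabilityMeasure D']
    {m : ℕ} {h : X → Bool} (hm : Measurable h) {c t : ℝ} (hc : |c| = 1) (ht : 0 ≤ t) :
    (Measure.pi (sampleLaw D D' : Fin m ⊕ Fin m → Measure X)).real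
      {x | m * t ≤ m * (c * (D.real (h ⁻¹' {true}) - D'.real (h ⁻¹' {true}))) -
        c * ∑ j, sampleSign j * (if h (x j) then 1 else 0)} ≤ Real.exp (-(m * t ^ 2)) := by
  set ν := Measure.pi (sampleLaw D D' : Fin m ⊕ Fin m → Measure X)
  let Y : Fin m ⊕ Fin m → X → ℝ := fun j x => -(c * sampleSign j) * (if h x then 1 else 0)
  have hYm : ∀ j, Measurable (Y j) := fun j => (measurable_label hm measurable_id).const_mul _
  have hYint : ∀ j, ∫ x, Y j (x j) ∂ν = -(c * sampleSign j) * (sampleLaw D D' j).real (h ⁻¹' {true}) :=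
    fun j => by simp only [Y]; rw [integral_const_mul, integral_label_comp_eval _ hm]
  have hind : iIndepFun (fun j (x : Fin m ⊕ Fin m → X) => Y j (x j) - ∫ x, Y j (x j) ∂ν) ν :=
    iIndepFun_pi (X := fun j x => Y j x - ∫ x, Y j (x j) ∂ν)
      fun j => ((hYm j).sub_const _).aemeasurable
  have hsub : ∀ j ∈ Finset.univ, HasSubgaussianMGF
      (fun (x : Fin m ⊕ Fin m → X) => Y j (x j) - ∫ x, Y j (x j) ∂ν) (1 / 4) ν := by
    intro j _
    have hmeas : AEMeasurable (fun x : Fin m ⊕ Fin m → X => Y j (x j)) ν :=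
      ((hYm j).comp (measurable_pi_apply j)).aemeasurable
    have hj : |c * sampleSign j| = 1 := by
      rw [abs_mul, hc]; rcases j with j | j <;> simp [sampleSign]
    rcases (abs_eq zero_le_one).1 hj with e | e
    · convert hasSubgaussianMGF_of_mem_Icc (a := -1) (b := 0) hmeas
        (Filter.Eventually.of_forall fun x => ?_) using 1
      · norm_num
      · simp only [Y, e]; split_ifs <;> simp
    · convert hasSubgaussianMGF_of_mem_Icc (a := 0) (b := 1) hmeas
        (Filter.Eventually.of_forall fun x => ?_) using 1
      · norm_num
      · simp only [Y, e]; split_ifs <;> simp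
  have key := HasSubgaussianMGF.measure_sum_ge_le_of_iIndepFun hind hsub (ε := m * t) (by positivity)
  have hsum : ∀ x : Fin m ⊕ Fin m → X, ∑ j, (Y j (x j) - ∫ x, Y j (x j) ∂ν) =
      m * (c * (D.real (h ⁻¹' {true}) - D'.real (h ⁻¹' {true}))) -
        c * ∑ j, sampleSign j * (if h (x j) then 1 else 0) := by
    intro x
    simp_rw [hYint]
    rw [Finset.sum_sub_distrib, Finset.mul_sum, Fintype.sum_sum_type (fun j => _ * Measure.real _ _)]
    simp only [Y, sampleSign, sampleLaw, Sum.elim_inl, Sum.elim_inr, Finset.sum_const,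
      Finset.card_univ, Fintype.card_fin, nsmul_eq_mul, neg_mul, Finset.sum_neg_distrib, mul_assoc]
    ring
  simp_rw [hsum] at key
  -- The `2m` summands, each with range of length one, have total variance proxy `2m / 4`, whence
  -- `(mt)² / (2 · m/2) = mt²`.
  refine key.trans (Real.exp_le_exp.2 (le_of_eq ?_))
  rcases Nat.eq_zero_or_pos m with rfl | hm0
  · simp
  have : (0 : ℝ) < m := by exact_mod_cast hm0
  simp
  field_simp
  ring

section empirical

variable {m : ℕ}

lemma isProbabilityMeasure_empiricalMeasure (hm : 0 < m) (x : Fin m → X) :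
    IsProbabilityMeasure (empiricalMeasure x) := by
  refine ⟨?_⟩
  rw [empiricalMeasure, Measure.smul_apply, Measure.finsetSum_apply]
  simp only [measure_univ, Finset.sum_const, Finset.card_univ, Fintype.card_fin, nsmul_eq_mul,
    mul_one, smul_eq_mul]
  exact ENNReal.inv_mul_cancel (by exact_mod_cast hm.ne') (ENNReal.natCast_ne_top m)

lemma mul_empiricalMeasure_real (hm : 0 < m) (x : Fin m → X) {h : X → Bool} (hh : Measurable h) :
    m * (empiricalMeasure x).real (h ⁻¹' {true}) = ∑ j, if h (x j) then (1 : ℝ) else 0 := by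
  have hm0 : (m : ℝ) ≠ 0 := by exact_mod_cast hm.ne'
  rw [empiricalMeasure, measureReal_ennreal_smul_apply, measureReal_def, Measure.finsetSum_apply,
    ENNReal.toReal_sum fun j _ => measure_ne_top _ _, ENNReal.toReal_inv, ENNReal.toReal_natCast,
    mul_inv_cancel_left₀ hm0]
  refine Finset.sum_congr rfl fun j _ => ?_
  rw [Measure.dirac_apply' _ (hh (measurableSet_singleton true))]
  by_cases hx : h (x j) <;> simp [hx]

lemma mul_empirical_sub (hm : 0 < m) (x : Fin m ⊕ Fin m → X) {h : X → Bool} (hh : Measurable h) :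
    m * ((empiricalMeasure fun j => x (.inl j)).real (h ⁻¹' {true}) -
      (empiricalMeasure fun j => x (.inr j)).real (h ⁻¹' {true})) =
      ∑ j, sampleSign j * (if h (x j) then 1 else 0) := by
  rw [mul_sub, mul_empiricalMeasure_real hm _ hh, mul_empiricalMeasure_real hm _ hh,
    Fintype.sum_sum_type]
  simp only [sampleSign, Sum.elim_inl, Sum.elim_inr, one_mul, neg_one_mul, Finset.sum_neg_distrib,
    sub_eq_add_neg]

lemma mul_supDiff_empirical_le (hm : 0 < m) (x : Fin m ⊕ Fin m → X) {H : Set (X → Bool)}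
    (hH : ∀ h ∈ H, Measurable h) :
    m * supDiff H (empiricalMeasure fun j => x (.inl j)) (empiricalMeasure fun j => x (.inr j)) ≤
      supSum H sampleSign x := by
  have hm0 : (0 : ℝ) < m := by exact_mod_cast hm
  rw [mul_comm, ← le_div_iff₀ hm0]
  refine Real.iSup_le ?_ (div_nonneg (Real.iSup_nonneg fun _ => abs_nonneg _) hm0.le)
  rintro ⟨_, h, hh, rfl⟩
  rw [le_div_iff₀ hm0, mul_comm, ← abs_of_nonneg hm0.le, ← abs_mul]
  have := abs_sum_le_supSum sampleSign x hh
  rwa [← mul_empirical_sub hm x (hH h hh)] at this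

end empirical

/-- The lower tail of the supremum of the empirical differences. -/
lemma pi_supDiff_le_le {H : Set (X → Bool)} (hne : H.Nonempty) (hmeas : ∀ h ∈ H, Measurable h)
    {D D' : Measure X} [IsProbabilityMeasure D] [IsProbabilityMeasure D'] {m : ℕ} (hm : 0 < m)
    {δ : ℝ} (h0 : 0 < δ) :
    (Measure.pi (sampleLaw D D' : Fin m ⊕ Fin m → Measure X)).real
      {x | supDiff H (empiricalMeasure fun j => x (.inl j)) (empiricalMeasure fun j => x (.inr j)) ≤
        supDiff H D D' - δ} ≤ Real.exp (-(m * δ ^ 2 / 2)) := by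
  have hm0 : (0 : ℝ) < m := by exact_mod_cast hm
  obtain ⟨h', hh'⟩ := hne
  have : Nonempty (supports H) := ⟨⟨_, h', hh', rfl⟩⟩
  -- The supremum need not be attained. Giving up `δ/4` leaves a deviation `3δ/4`, and `(3/4)² =
  -- 9/16` is still at least `1/2`.
  obtain ⟨⟨_, h, hh, rfl⟩, hlt⟩ := exists_lt_of_lt_ciSup
    (show supDiff H D D' - δ / 4 < supDiff H D D' by linarith)
  set a := D.real (h ⁻¹' {true}) - D'.real (h ⁻¹' {true}) with ha
  obtain ⟨c, hc, hca⟩ : ∃ c : ℝ, |c| = 1 ∧ c * a = |a| := by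
    rcases abs_cases a with ⟨e, -⟩ | ⟨e, -⟩
    · exact ⟨1, by simp, by rw [e]; ring⟩
    · exact ⟨-1, by simp, by rw [e]; ring⟩
  have key := pi_single_le (D := D) (D' := D') (m := m) (hmeas h hh) hc
    (t := 3 / 4 * δ) (by positivity)
  refine (measureReal_mono fun x hx => ?_).trans (key.trans (Real.exp_le_exp.2 ?_))
  · have := isProbabilityMeasure_empiricalMeasure hm fun j => x (.inl j)
    have := isProbabilityMeasure_empiricalMeasure hm fun j => x (.inr j)
    have h1 := abs_measureReal_sub_le_supDiff (empiricalMeasure fun j => x (.inl j))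
      (empiricalMeasure fun j => x (.inr j)) hh
    set b := (empiricalMeasure fun j => x (.inl j)).real (h ⁻¹' {true}) -
      (empiricalMeasure fun j => x (.inr j)).real (h ⁻¹' {true}) with hb
    have h2 : c * b ≤ |b| := by
      refine (le_abs_self _).trans ?_
      rw [abs_mul, hc, one_mul]
    simp only [Set.mem_ofPred_eq] at hx hlt ⊢
    rw [← mul_empirical_sub hm x (hmeas h hh), ← ha, ← hb, hca, mul_left_comm c, ← mul_sub]
    exact mul_le_mul_of_nonneg_left (by linarith) hm0.le
  · nlinarith [mul_pos hm0 (pow_pos h0 2)]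

/-! ### Both tails together, and all sources -/

/-- The two-sided deviation bound for one pair of distributions. -/
lemma pi_abs_supDiff_sub_le {H : Set (X → Bool)} {D D' : Measure X} [IsProbabilityMeasure D]
    [IsProbabilityMeasure D'] {m d : ℕ} {δ : ℝ} (h0 : 0 < δ) (hm : 0 < m) (hVC : HasVCDim H d)
    (hdm : d ≤ m) {𝒟 : Set (Measure X)} (hH : IsMeasurableClass H 𝒟) (hD : D ∈ 𝒟) (hD' : D' ∈ 𝒟) :
    (Measure.pi (sampleLaw D D' : Fin m ⊕ Fin m → Measure X)).real
      {x | δ ≤ |supDiff H D D' - supDiff H (empiricalMeasure fun j => x (.inl j))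
        (empiricalMeasure fun j => x (.inr j))|} ≤
      4 * ((Real.exp 1 * m / d) ^ d * Real.exp (-(m * δ ^ 2 / 2))) := by
  have hm0 : (0 : ℝ) < m := by exact_mod_cast hm
  rcases lt_or_ge 1 δ with h1 | h1
  · have : {x : Fin m ⊕ Fin m → X | δ ≤ |supDiff H D D' - supDiff H
        (empiricalMeasure fun j => x (.inl j)) (empiricalMeasure fun j => x (.inr j))|} = ∅ := by
      refine Set.eq_empty_of_forall_notMem fun x hx => ?_
      have := isProbabilityMeasure_empiricalMeasure hm fun j => x (.inl j)
      have := isProbabilityMeasure_empiricalMeasure hm fun j => x (.inr j)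
      refine absurd (h1.trans_le hx) (not_lt.2 (abs_le.2 ⟨?_, ?_⟩))
      · linarith [supDiff_nonneg (H := H) D D', supDiff_le_one (H := H)
          (empiricalMeasure fun j => x (.inl j)) (empiricalMeasure fun j => x (.inr j))]
      · linarith [supDiff_le_one (H := H) D D', supDiff_nonneg (H := H)
          (empiricalMeasure fun j => x (.inl j)) (empiricalMeasure fun j => x (.inr j))]
    rw [this, measureReal_empty]
    positivity
  have hup := pi_supSum_ge_le_of_le_one (m := m) h0 h1 hVC hdm hH hD hD'
  have hlo := pi_supDiff_le_le (D := D) (D' := D') hVC.nonempty hH.measurable hm h0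
  have hone : 1 ≤ (Real.exp 1 * m / d) ^ d := by
    rcases Nat.eq_zero_or_pos d with rfl | hd
    · simp
    have hd0 : (0 : ℝ) < d := by exact_mod_cast hd
    refine one_le_pow₀ ?_
    rw [one_le_div hd0]
    have : (d : ℝ) ≤ m := by exact_mod_cast hdm
    nlinarith [Real.add_one_le_exp (1 : ℝ)]
  have hexp := le_mul_of_one_le_left (Real.exp_pos (-(m * δ ^ 2 / 2))).le hone
  -- The upper tail contributes a factor `2` and the lower tail at most `1`, within the allowed `4`.
  refine (measureReal_mono fun x hx => ?_).trans ((measureReal_union_le _ _).trans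
    ((add_le_add hup hlo).trans (by linarith [Real.exp_pos (-(m * δ ^ 2 / 2))])))
  simp only [Set.mem_ofPred_eq, Set.mem_union] at hx ⊢
  rcases le_abs.1 hx with h | h
  · exact Or.inr (by linarith)
  · refine Or.inl (le_trans ?_ (mul_supDiff_empirical_le hm x hH.measurable))
    gcongr
    linarith

lemma exists_le_abs_sub_of_le_abs_iSup_sub {ι : Type*} [Finite ι] [Nonempty ι] {a b : ι → ℝ} {ε : ℝ}
    (h : ε ≤ |(⨆ i, a i) - ⨆ i, b i|) : ∃ i, ε ≤ |a i - b i| := by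
  rcases le_abs.1 h with h | h
  · obtain ⟨i, hi⟩ := exists_eq_ciSup_of_finite (f := a)
    exact ⟨i, le_trans (by linarith [le_ciSup (Set.finite_range b).bddAbove i]) (le_abs_self _)⟩
  · obtain ⟨i, hi⟩ := exists_eq_ciSup_of_finite (f := b)
    exact ⟨i, le_trans (by linarith [le_ciSup (Set.finite_range a).bddAbove i]) (neg_le_abs _)⟩

end MultiSource

theorem mainTheorem3 {X : Type*} [MeasurableSpace X] {Ω : Type*} [MeasurableSpace Ω]
    (μ : Measure Ω) [IsProbabilityMeasure μ]
    (k m d : ℕ) (hk : 1 ≤ k) (hdm : d ≤ m)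
    (DT : Measure X) [IsProbabilityMeasure DT]
    (DS : Fin k → Measure X) [∀ i, IsProbabilityMeasure (DS i)]
    (H : Set (X → Bool)) (hVC : MultiSource.HasVCDim H d)
    (hH : MultiSource.IsMeasurableClass H (insert DT (Set.range DS)))
    (T : Fin m → Ω → X) (S : Fin k → Fin m → Ω → X)
    (hT : ∀ j, HasLaw (T j) DT μ)
    (hS : ∀ i j, HasLaw (S i j) (DS i) μ)
    (hindep : iIndepFun (Sum.elim T (fun p : Fin k × Fin m => S p.1 p.2)) μ)
    (ε : ℝ) (hε : 0 < ε) :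
    μ.real {ω | ε ≤ |MultiSource.multiHDivergence H DT DS -
        MultiSource.multiHDivergence H (MultiSource.empiricalMeasure (fun j => T j ω))
          (fun i => MultiSource.empiricalMeasure (fun j => S i j ω))|} ≤
      4 * (k : ℝ) * (Real.exp 1 * (m : ℝ) / (d : ℝ)) ^ d * Real.exp (-((m : ℝ) * ε ^ 2) / 8) := by
  -- For `m = 0` the empirical measures are zero, not probability measures, but the bound is `4k ≥
  -- 1`.
  rcases Nat.eq_zero_or_pos m with rfl | hm
  · obtain rfl : d = 0 := by omega
    have hk' : (1 : ℝ) ≤ k := by exact_mod_cast hk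
    refine measureReal_le_one.trans ?_
    simp
    linarith
  have : Nonempty (Fin k) := ⟨⟨0, hk⟩⟩
  let Z : Fin k → Ω → Fin m ⊕ Fin m → X := fun i ω => Sum.elim (fun j => T j ω) fun j => S i j ω
  have hlaw : ∀ i, HasLaw (Z i) (Measure.pi (MultiSource.sampleLaw DT (DS i))) μ := by
    intro i
    have hinj : Function.Injective (Sum.map id (fun j => (i, j)) : Fin m ⊕ Fin m → Fin m ⊕ Fin k × Fin m) :=
      Sum.map_injective.2 ⟨Function.injective_id, fun _ _ h => (Prod.ext_iff.1 h).2⟩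
    have h1 := hindep.precomp hinj
    have h2 := h1.hasLaw_pi (μ := MultiSource.sampleLaw DT (DS i)) fun j => by
      rcases j with j | j
      · exact hT j
      · exact hS i j
    convert h2 using 1
    funext ω j
    rcases j with j | j <;> rfl
  have hi : ∀ i, μ.real (Z i ⁻¹' {x | ε / 2 ≤ |MultiSource.supDiff H DT (DS i) - MultiSource.supDiff H
      (MultiSource.empiricalMeasure fun j => x (.inl j))
      (MultiSource.empiricalMeasure fun j => x (.inr j))|}) ≤
      4 * ((Real.exp 1 * m / d) ^ d * Real.exp (-(m * (ε / 2) ^ 2 / 2))) := by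
    intro i
    refine le_trans ?_ (MultiSource.pi_abs_supDiff_sub_le (D := DT) (D' := DS i) (half_pos hε) hm
      hVC hdm hH (Set.mem_insert _ _) (Set.mem_insert_of_mem _ (Set.mem_range_self i)))
    rw [← (hlaw i).map_eq]
    have := Measure.isProbabilityMeasure_map (hlaw i).aemeasurable
    -- Only this inequality between a preimage and the image law is available without measurability
    -- of the event, and it is the direction needed.
    exact ENNReal.toReal_mono (measure_ne_top _ _) (Measure.le_map_apply (hlaw i).aemeasurable _)
  refine (measureReal_mono (fun ω hω => ?_)).trans ((measureReal_iUnion_fintype_le _).trans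
    ((Finset.sum_le_sum fun i _ => hi i).trans (le_of_eq ?_)))
  · obtain ⟨i, hi⟩ := MultiSource.exists_le_abs_sub_of_le_abs_iSup_sub (show ε ≤ |_| from hω)
    refine Set.mem_iUnion.2 ⟨i, ?_⟩
    change ε ≤ |2 * MultiSource.supDiff H DT (DS i) - 2 * MultiSource.supDiff H
      (MultiSource.empiricalMeasure fun j => T j ω) (MultiSource.empiricalMeasure fun j => S i j ω)| at hi
    rw [← mul_sub, abs_mul, abs_two] at hi
    change ε / 2 ≤ |_ - MultiSource.supDiff H (MultiSource.empiricalMeasure fun j => T j ω)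
      (MultiSource.empiricalMeasure fun j => S i j ω)|
    linarith
  · have : -(m * (ε / 2) ^ 2 / 2) = -((m : ℝ) * ε ^ 2) / 8 := by ring
    rw [this]
    simp
    ring
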